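/- **Setting.** Let $I=\{t_1,\dots,t_n\}$ be tuples over attributes $A_1,\dots,A_m$ with values in a linearly ordered domain, and let $\Sigma$ be a set of denial constraints $\neg(P_1\wedge P_2\wedge\cdots)$ with predicates $P=(t[A_p]\,\phi\,t'[A_q])$, $\phi\in\{>,\ge,<,\le,=,\ne\}$. Two different tuples $t_i,t_l$ are *in conflict* if $(t_i,t_l)$ or $(t_l,t_i)$ violates some constraint in $\Sigma$; $I_C$ is the set of tuples involved in a conflict. Let $k\ge 0$ be an integer and let $G,\gamma$ be real constants. *Weights.* Let $d_{ilj}$ be the distance of $t_i[A_j]$ and $t_l[A_j]$ (for any real-valued distance function of the values of $A_j$), let $D_{ilj}$ be the vector made of $1$ and the $d_{ila}$, $a\neq j$, and let $f_{lj}$ be any (regression) function of such vectors. Put $\ell(t_i,t_l;A_j)=|d_{ilj}-f_{lj}(D_{ilj})|$ and $\ell(t_i,t_l)=\sum_j\ell(t_i,t_l;A_j)$, and let $\ell(t_i)$ be the sum of the $k$ smallest values $\ell(t_i,t_l)$, $l\neq i$ (of all of them if there are fewer than $k$). Let $u_i$ be the number of $t_l$ in conflict with $t_i$ with $\ell(t_i)<\ell(t_l)$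 minus the number of those with $\ell(t_i)>\ell(t_l)$. Let $\Gamma_i=\prod_{s=1}^{|u_i|}(1+\gamma/s)$ if $u_i\ge0$, and the inverse of this product if $u_i<0$. Finally $L(t_i,t_l)=\sum_j (G-\ell(t_i,t_l;A_j))\,\Gamma_i$. *Potential providers.* If there is a $t_l\in I\setminus I_C$, $l\ne i$, for which exactly $k$ tuples $t_s\in I\setminus I_C$, $s\neq i$, satisfy $L(t_i,t_l)\le L(t_i,t_s)$, let $\overline M(t_i)=\{t_r : r\neq i,\ L(t_i,t_r)\ge L(t_i,t_l)\}$ (this does not depend on the choice of $t_l$); otherwise let $\overline M(t_i)=I\setminus\{t_i\}$. *The programs.* The original ILP has a variable $x_i\in\{0,1\}$ for each $t_i\in I_C$ and a variable $y_{il}\in\{0,1\}$ for each $t_i\in I$ and $t_l\in\overline M(t_i)$. It maximizes $\sum_{t_i\in I}\sum_{t_l\in\overline M(t_i)}y_{il}L(t_i,t_l)$ subject to 1. $x_i+x_l\le1$ whenever $t_i,t_l$ are in conflict; 2. $y_{il}\le x_i$ if $t_i\in I_C$, and $y_{il}\le x_l$ if $t_l\in I_C$; 3. $\sum_{t_l\in\overline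 M(t_i)}y_{il}\le k$ if $t_i\notin I_C$, and $\sum_{t_l\in\overline M(t_i)}y_{il}\le kx_i$ if $t_i\in I_C$. A *clique* is a set $I_q\subseteq I_C$ any two different elements of which are in conflict. The *LP with clique constraints* is obtained from the ILP by relaxing $x_i,y_{il}\in\{0,1\}$ to $x_i,y_{il}\in[0,1]$ and adding to (1) the constraint $\sum_{t_i\in I_q}x_i\le1$ for every clique $I_q\subseteq I_C$. An *LP solution* is an optimal extreme point of the feasible region of this LP. A feasible $X=[x_i,y_{il}]$ is an *$\mathcal X$-solution* if $(x_i)_{t_i\in I_C}$ is an extreme point of the polytope of all $x\in[0,1]^{I_C}$ that satisfy (1) and all clique constraints. *Conflict structure.* A *chain* is a set of conflict tuples that can be listed as a sequence of distinct tuples such that two of them are in conflict if and only if they are consecutive. A *disjoint clique* is a maximal clique that is disjoint from every other maximal clique. The conflicts *consist of chains and disjoint cliques* if there are pairwise disjoint subsets of $I_C$, each of them a chain or a disjoint clique, such that any two tuples in conflict lie together in one of these subsets. **Proposition.** Suppose that the conflicts consist of chains and disjoint cliques. If a solution $X$ of the LP with the clique constraints for all cliques $I_q\subseteq I_C$ is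 an $\mathcal X$-solution, then $X$ is an exact (that is, optimal) solution of the original ILP; in particular all its entries are $0$ or $1$. -/

import Mathlib

/-! Subset repair under denial constraints: the integer program, its linear relaxation with
clique constraints, and the conflict structures (chains, disjoint cliques). -/

noncomputable section

open Classical

/-- The six comparison operators of denial constraints. -/
inductive CompOp
  | gt | ge | lt | le | eq | ne

/-- `a op b` on a linearly ordered domain of values. -/
def CompOp.Holds {V : Type*} [LinearOrder V] : CompOp → V → V → Prop
  | .gt, a, b => a > b
  | .ge, a, b => a ≥ b
  | .lt, a, b => a < b
  | .le, a, b => a ≤ b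
  | .eq, a, b => a = b
  | .ne, a, b => a ≠ b

/-- A predicate `t[left] op t'[right]` on a pair of tuples over `m` attributes. -/
structure DCPredicate (m : ℕ) where
  left : Fin m
  op : CompOp
  right : Fin m

/-- The pair `(t, t')` satisfies the predicate `P`. -/
def DCPredicate.Holds {V : Type*} [LinearOrder V] {m : ℕ} (P : DCPredicate m)
    (t t' : Fin m → V) : Prop :=
  P.op.Holds (t P.left) (t' P.right)

/-- A denial constraint `¬ (P₁ ∧ P₂ ∧ ⋯)`, given by its list of predicates. -/
abbrev DenialConstraint (m : ℕ) := List (DCPredicate m)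

/-- The pair `(t, t')` satisfies the denial constraint: some predicate fails. -/
def DenialConstraint.SatisfiedBy {V : Type*} [LinearOrder V] {m : ℕ} (φ : DenialConstraint m)
    (t t' : Fin m → V) : Prop :=
  ∃ P ∈ φ, ¬ P.Holds t t'

/-- The input of the optimal subset repair problem. The distance functions and the (learned)
regression models may be any functions, and `G`, `γ` any constants. -/
structure RepairInstance (V : Type*) [LinearOrder V] (n m : ℕ) where
  /-- The tuples `t₁, …, tₙ`, each with `m` attribute values. -/
  tuple : Fin n → Fin m → V
  /-- The set of denial constraints. -/
  constraints : Set (DenialConstraint m)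
  /-- The distance between two values of an attribute. -/
  attrDist : Fin m → V → V → ℝ
  /-- The dependency model `f_{lj}` of tuple `l` and attribute `j`: it predicts the distance on `j`
  from the vector made of the constant `1` (index `none`) and the distances on the attributes
  other than `j`. -/
  model : Fin n → (j : Fin m) → (Option {a : Fin m // a ≠ j} → ℝ) → ℝ
  /-- The number of providers of a tuple. -/
  k : ℕ
  /-- The normalizing constant. -/
  G : ℝ
  /-- The enhancement constant. -/
  γ : ℝ

namespace RepairInstance

variable {V : Type*} [LinearOrder V] {n m : ℕ} (S : RepairInstance V n m)

/-! ### Conflicts -/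

/-- The ordered pair `(tᵢ, tₗ)` satisfies all the constraints. -/
def PairSatisfies (i l : Fin n) : Prop :=
  ∀ φ ∈ S.constraints, φ.SatisfiedBy (S.tuple i) (S.tuple l)

/-- Two different tuples are in conflict if they violate a constraint, in one of the two orders
(a denial constraint ranges over all ordered pairs). -/
def Conflict (i l : Fin n) : Prop :=
  i ≠ l ∧ (¬ S.PairSatisfies i l ∨ ¬ S.PairSatisfies l i)

/-- The set `I_C` of tuples involved in a conflict. -/
def conflictSet : Finset (Fin n) := Finset.univ.filter fun i => ∃ l, S.Conflict i l

/-- The type of the elements of `I_C`. -/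
abbrev ConflictTuple := {i : Fin n // i ∈ S.conflictSet}

/-! ### Conformance loss, weights and potential providers -/

/-- The distance `d_{ilj}`. -/
def d (i l : Fin n) (j : Fin m) : ℝ := S.attrDist j (S.tuple i j) (S.tuple l j)

/-- The distance vector `D_{ilj}`: a `1` followed by the distances on the attributes other
than `j`. -/
def distVec (i l : Fin n) (j : Fin m) : Option {a : Fin m // a ≠ j} → ℝ
  | none => 1
  | some a => S.d i l a

/-- The conformance loss `ℓ(tᵢ, tₗ; Aⱼ)`. -/
def attrLoss (i l : Fin n) (j : Fin m) : ℝ := |S.d i l j - S.model l j (S.distVec i l j)|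

/-- The conformance loss `ℓ(tᵢ, tₗ)`. -/
def pairLoss (i l : Fin n) : ℝ := ∑ j, S.attrLoss i l j

/-- The conformance loss `ℓ(tᵢ)`: the sum of the `k` smallest losses `ℓ(tᵢ, tₗ)` over the other
tuples `tₗ`. -/
def loss (i : Fin n) : ℝ :=
  ((((Finset.univ.erase i).val.map fun l => S.pairLoss i l).sort (· ≤ ·)).take S.k).sum

/-- The number of conflicting tuples with a larger loss minus the number of those with a smaller
loss. -/
def u (i : Fin n) : ℤ :=
  ((Finset.univ.filter fun l => S.loss i < S.loss l ∧ S.Conflict i l).card : ℤ)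
    - ((Finset.univ.filter fun l => S.loss l < S.loss i ∧ S.Conflict i l).card : ℤ)

/-- The amplification factor `Γᵢ`. -/
def amp (i : Fin n) : ℝ :=
  if 0 < S.u i then ∏ s ∈ Finset.Icc 1 (S.u i).natAbs, (1 + S.γ / (s : ℝ))
  else if S.u i = 0 then 1
  else (∏ s ∈ Finset.Icc 1 (S.u i).natAbs, (1 + S.γ / (s : ℝ)))⁻¹

/-- The weight `L(tᵢ, tₗ)` which `tₗ` provides to `tᵢ`. -/
def weight (i l : Fin n) : ℝ := ∑ j, (S.G - S.attrLoss i l j) * S.amp i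

/-- `tₗ` is a conflict-free provider (different from `tᵢ`) such that exactly `k` conflict-free
providers have a weight at least as large as its own. -/
def IsThreshold (i l : Fin n) : Prop :=
  l ≠ i ∧ l ∉ S.conflictSet ∧
    (Finset.univ.filter fun s =>
      s ≠ i ∧ s ∉ S.conflictSet ∧ S.weight i l ≤ S.weight i s).card = S.k

/-- The set `M̄(tᵢ)` of potential providers of `tᵢ`: the other tuples whose weight is at least that
of the threshold provider (all thresholds have the same weight; if there is none, then every
other tuple is a potential provider). -/
def providers (i : Fin n) : Finset (Fin n) :=
  Finset.univ.filter fun r => r ≠ i ∧ ∀ l, S.IsThreshold i l → S.weight i l ≤ S.weight i r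

/-! ### Cliques and chains -/

/-- A set of conflict tuples is a clique if any two of its elements are in conflict. -/
def IsClique (q : Finset S.ConflictTuple) : Prop :=
  ∀ i ∈ q, ∀ l ∈ q, i ≠ l → S.Conflict i l

/-- A clique to which no further conflict tuple can be added. -/
def IsMaximalClique (q : Finset S.ConflictTuple) : Prop :=
  S.IsClique q ∧ ∀ i, i ∉ q → ∃ l ∈ q, ¬ S.Conflict i l

/-- A maximal clique that is disjoint from every other maximal clique. -/
def IsDisjointClique (q : Finset S.ConflictTuple) : Prop :=
  S.IsMaximalClique q ∧ ∀ q', S.IsMaximalClique q' → Disjoint q q' ∨ q' = q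

/-- The elements of `p` form a chain: they can be listed without repetition so that the conflicts
among them are exactly those between consecutive tuples. -/
def IsChain (p : Finset S.ConflictTuple) : Prop :=
  ∃ (s : ℕ) (c : Fin s → S.ConflictTuple), Function.Injective c ∧
    (∀ i, i ∈ p ↔ ∃ a, c a = i) ∧
    ∀ a b : Fin s, S.Conflict (c a) (c b) ↔ ((a : ℕ) + 1 = b ∨ (b : ℕ) + 1 = a)

/-- The conflicts consist of chains and disjoint cliques: there are pairwise disjoint sets of
tuples, each a chain or a disjoint clique, such that each conflict occurs within one of them. -/
def ConsistsOfChainsAndDisjointCliques : Prop :=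
  ∃ parts : Set (Finset S.ConflictTuple),
    (∀ p ∈ parts, S.IsChain p ∨ S.IsDisjointClique p) ∧
    (∀ p ∈ parts, ∀ p' ∈ parts, p ≠ p' → Disjoint p p') ∧
    ∀ i l : S.ConflictTuple, S.Conflict i l → ∃ p ∈ parts, i ∈ p ∧ l ∈ p

/-! ### The integer program and its relaxation with clique constraints -/

/-- Vectors `X = [xᵢ, y_{il}]` of values of the decision variables: an `xᵢ` for each `tᵢ ∈ I_C`,
and a `y_{il}` for each `tᵢ ∈ I` and `tₗ ∈ M̄(tᵢ)`. -/
abbrev DecisionVec : Type :=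
  (S.ConflictTuple → ℝ) × ((Σ i : Fin n, {l : Fin n // l ∈ S.providers i}) → ℝ)

/-- The non-conflict constraints `xᵢ + xₗ ≤ 1`. -/
def NonConflict (x : S.ConflictTuple → ℝ) : Prop :=
  ∀ i l : S.ConflictTuple, S.Conflict i l → x i + x l ≤ 1

/-- The clique constraints, for all cliques. -/
def CliqueConstraints (x : S.ConflictTuple → ℝ) : Prop :=
  ∀ q : Finset S.ConflictTuple, S.IsClique q → ∑ i ∈ q, x i ≤ 1

/-- The constraints that link the variables `y_{il}` to the `xᵢ` and bound the number of
providers. -/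
structure ProviderConstraints (X : S.DecisionVec) : Prop where
  le_receiver : ∀ (i : Fin n) (hi : i ∈ S.conflictSet) (l : {l : Fin n // l ∈ S.providers i}),
    X.2 ⟨i, l⟩ ≤ X.1 ⟨i, hi⟩
  le_provider : ∀ (i : Fin n) (l : {l : Fin n // l ∈ S.providers i}) (hl : l.1 ∈ S.conflictSet),
    X.2 ⟨i, l⟩ ≤ X.1 ⟨l.1, hl⟩
  sum_le : ∀ i : Fin n, i ∉ S.conflictSet →
    ∑ l : {l : Fin n // l ∈ S.providers i}, X.2 ⟨i, l⟩ ≤ (S.k : ℝ)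
  sum_le_mul : ∀ (i : Fin n) (hi : i ∈ S.conflictSet),
    ∑ l : {l : Fin n // l ∈ S.providers i}, X.2 ⟨i, l⟩ ≤ (S.k : ℝ) * X.1 ⟨i, hi⟩

/-- The objective function `∑ᵢ ∑ₗ y_{il} L(tᵢ, tₗ)`. -/
def objective (X : S.DecisionVec) : ℝ :=
  ∑ i : Fin n, ∑ l : {l : Fin n // l ∈ S.providers i}, X.2 ⟨i, l⟩ * S.weight i l

/-- The feasible set of the original integer program (no clique constraints). -/
def ilpRegion : Set S.DecisionVec :=
  {X | (∀ i, X.1 i = 0 ∨ X.1 i = 1) ∧ (∀ p, X.2 p = 0 ∨ X.2 p = 1) ∧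
    S.NonConflict X.1 ∧ S.ProviderConstraints X}

/-- An exact solution of the integer program. -/
def IsILPSolution (X : S.DecisionVec) : Prop :=
  X ∈ S.ilpRegion ∧ ∀ X' ∈ S.ilpRegion, S.objective X' ≤ S.objective X

/-- The region cut out in the space of the variables `xᵢ ∈ [0, 1]` by the non-conflict constraints
together with the clique constraints. -/
def xRegion : Set (S.ConflictTuple → ℝ) :=
  {x | (∀ i, 0 ≤ x i ∧ x i ≤ 1) ∧ S.NonConflict x ∧ S.CliqueConstraints x}

/-- The feasible set of the linear relaxation with the clique constraints added. -/
def lpRegion : Set S.DecisionVec :=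
  {X | X.1 ∈ S.xRegion ∧ (∀ p, 0 ≤ X.2 p ∧ X.2 p ≤ 1) ∧ S.ProviderConstraints X}

/-- A solution returned by the linear program: an optimal extreme point of its feasible region. -/
def IsLPSolution (X : S.DecisionVec) : Prop :=
  X ∈ Set.extremePoints ℝ S.lpRegion ∧ ∀ X' ∈ S.lpRegion, S.objective X' ≤ S.objective X

/-- An `𝒳`-solution: a feasible solution whose `x`-part is an extreme point of the region of
the `x`-constraints. -/
def IsXSolution (X : S.DecisionVec) : Prop :=
  X ∈ S.lpRegion ∧ X.1 ∈ Set.extremePoints ℝ S.xRegion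

end RepairInstance

end

/-! Since X maximizes the objective over the LP region and that region contains every feasible point
of the ILP (`ilpRegion_subset_lpRegion`), it is enough that X is integral. Integrality comes from
perturbation: at an extreme point, a nonzero direction that vanishes on all tight constraints could
be followed both ways, which is impossible (`eq_zero_of_eventually_add_smul_mem`). At a fractional
entry such a direction is built. For the x-part, every conflict tuple lies in a chain or a clique
that is closed under conflicts. In a clique, mass is shifted between two positive entries, or one
entry is moved alone if the sum is below 1; on a chain, the fractional entries move by alternating
signs. Once x is integral, all bounds on the y-variables are integers and each row can be treated
separately: two fractional entries exchange mass, or one moves alone if the row sum is not an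
integer. -/

section

open Classical Filter Topology

/-! ### Perturbation of extreme points -/

/-- An inequality between reals survives small perturbations in a direction along which it is
constant if it is tight. -/
theorem eventually_add_mul_le {a b v : ℝ} (h : a ≤ b) (hv : a = b → v = 0) :
    ∀ᶠ ε : ℝ in 𝓝 0, a + ε * v ≤ b := by
  rcases h.eq_or_lt with h' | h'
  · simp [hv h', h]
  · have hc : Tendsto (fun ε : ℝ => a + ε * v) (𝓝 0) (𝓝 a) := by
      have : Continuous fun ε : ℝ => a + ε * v := by fun_prop
      simpa using this.tendsto 0
    exact (hc.eventually_lt_const h').mono fun _ => le_of_lt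

/-- No nonzero direction can be followed both ways from an extreme point. -/
theorem eq_zero_of_eventually_add_smul_mem {E : Type*} [AddCommGroup E] [Module ℝ E] {P : Set E}
    {x d : E} (hx : x ∈ Set.extremePoints ℝ P) (h : ∀ᶠ ε : ℝ in 𝓝 0, x + ε • d ∈ P) : d = 0 := by
  have hneg : ∀ᶠ ε : ℝ in 𝓝 0, x + (-ε) • d ∈ P := by
    have : Tendsto (fun ε : ℝ => -ε) (𝓝 0) (𝓝 0) := by simpa using (continuous_neg.tendsto (0 : ℝ))
    exact this.eventually h
  obtain ⟨ε, ⟨h1, h2⟩, hε⟩ :=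
    (((h.and hneg).filter_mono nhdsWithin_le_nhds).and
      (self_mem_nhdsWithin : Set.Ioi (0 : ℝ) ∈ 𝓝[>] 0)).exists
  -- `x` is the midpoint of the two perturbed points.
  have hmem : x ∈ openSegment ℝ (x + ε • d) (x + (-ε) • d) :=
    ⟨1 / 2, 1 / 2, by norm_num, by norm_num, by norm_num, by module⟩
  have heq := hx.2 h1 h2 hmem
  have h0 : ε • d = 0 := by simpa using heq
  exact (smul_eq_zero.1 h0).resolve_left (ne_of_gt hε)

theorem eq_zero_or_one_of_eq_intCast {r : ℝ} (h0 : 0 ≤ r) (h1 : r ≤ 1) {z : ℤ} (hz : r = z) :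
    r = 0 ∨ r = 1 := by
  subst hz
  have h0' : 0 ≤ z := by exact_mod_cast h0
  have h1' : z ≤ 1 := by exact_mod_cast h1
  have : z = 0 ∨ z = 1 := by omega
  rcases this with rfl | rfl <;> simp

theorem exists_intCast_of_eq_zero_or_one {r : ℝ} (h : r = 0 ∨ r = 1) : ∃ z : ℤ, r = z := by
  rcases h with rfl | rfl
  · exact ⟨0, by simp⟩
  · exact ⟨1, by simp⟩

namespace RepairInstance

variable {V : Type*} [LinearOrder V] {n m : ℕ} {S : RepairInstance V n m}

/-! ### Integrality of the x-variables -/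

theorem Conflict.symm {i l : Fin n} (h : S.Conflict i l) : S.Conflict l i :=
  ⟨h.1.symm, h.2.symm⟩

theorem ConflictTuple.exists_conflict (i : S.ConflictTuple) :
    ∃ l : S.ConflictTuple, S.Conflict i l := by
  obtain ⟨i, hi⟩ := i
  obtain ⟨l, hl⟩ : ∃ l, S.Conflict i l := by simpa [conflictSet] using hi
  exact ⟨⟨l, by simpa [conflictSet] using ⟨i, hl.symm⟩⟩, hl⟩

theorem isClique_singleton (i : S.ConflictTuple) : S.IsClique {i} := by
  intro a ha b hb hab
  rw [Finset.mem_singleton] at ha hb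
  exact absurd (ha.trans hb.symm) hab

theorem isClique_pair {i l : S.ConflictTuple} (h : S.Conflict i l) : S.IsClique {i, l} := by
  intro a ha b hb hab
  simp only [Finset.mem_insert, Finset.mem_singleton] at ha hb
  rcases ha with rfl | rfl <;> rcases hb with rfl | rfl
  · exact absurd rfl hab
  · exact h
  · exact h.symm
  · exact absurd rfl hab

/-- The bounds `xᵢ ≤ 1` and the non-conflict constraints are instances of the clique constraints. -/
theorem mem_xRegion_iff {x : S.ConflictTuple → ℝ} :
    x ∈ S.xRegion ↔ (∀ i, 0 ≤ x i) ∧ S.CliqueConstraints x := by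
  refine ⟨fun h => ⟨fun i => (h.1 i).1, h.2.2⟩, fun h => ⟨fun i => ⟨h.1 i, ?_⟩, ?_, h.2⟩⟩
  · simpa using h.2 _ (isClique_singleton i)
  · intro i l hil
    have hne : i ≠ l := fun e => hil.1 (congrArg Subtype.val e)
    simpa [Finset.sum_pair hne] using h.2 _ (isClique_pair hil)

/-- A direction that respects the tight constraints at an extreme point vanishes. -/
theorem direction_eq_zero {x d : S.ConflictTuple → ℝ} (hx : x ∈ Set.extremePoints ℝ S.xRegion)
    (h0 : ∀ i, x i = 0 → d i = 0)
    (hq : ∀ q, S.IsClique q → ∑ i ∈ q, x i = 1 → ∑ i ∈ q, d i = 0) : d = 0 := by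
  refine eq_zero_of_eventually_add_smul_mem hx ?_
  obtain ⟨hx0, hxq⟩ := mem_xRegion_iff.1 hx.1
  have e1 : ∀ᶠ ε : ℝ in 𝓝 0, ∀ i, -x i + ε * -d i ≤ 0 :=
    eventually_all.2 fun i => eventually_add_mul_le (by linarith [hx0 i])
      fun h => by rw [h0 i (by linarith), neg_zero]
  have e2 : ∀ᶠ ε : ℝ in 𝓝 0, ∀ q : Finset S.ConflictTuple, S.IsClique q →
      ∑ i ∈ q, x i + ε * ∑ i ∈ q, d i ≤ 1 := by
    refine eventually_all.2 fun q => ?_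
    by_cases hc : S.IsClique q
    · exact (eventually_add_mul_le (hxq q hc) (hq q hc)).mono fun _ h _ => h
    · exact Eventually.of_forall fun _ h => absurd h hc
  filter_upwards [e1, e2] with ε h1 h2
  refine mem_xRegion_iff.2 ⟨fun i => ?_, fun q hc => ?_⟩
  · have := h1 i
    simp only [Pi.add_apply, Pi.smul_apply, smul_eq_mul]
    linarith
  · simpa [Finset.sum_add_distrib, Finset.mul_sum] using h2 q hc

/-- A clique that meets a set closed under conflicts is contained in it. -/
theorem IsClique.subset_of_mem {p q : Finset S.ConflictTuple}
    (hp : ∀ i ∈ p, ∀ l : S.ConflictTuple, S.Conflict i l → l ∈ p) (hq : S.IsClique q)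
    {i : S.ConflictTuple} (hip : i ∈ p) (hiq : i ∈ q) : q ⊆ p := by
  intro l hl
  by_cases h : i = l
  · exact h ▸ hip
  · exact hp i hip l (hq i hiq l hl h)

/-- Extreme points are integral on cliques closed under conflicts. -/
theorem eq_zero_or_one_of_mem_clique {x : S.ConflictTuple → ℝ}
    (hx : x ∈ Set.extremePoints ℝ S.xRegion) {p : Finset S.ConflictTuple}
    (hp : ∀ i ∈ p, ∀ l : S.ConflictTuple, S.Conflict i l → l ∈ p) (hpc : S.IsClique p)
    {i : S.ConflictTuple} (hi : i ∈ p) : x i = 0 ∨ x i = 1 := by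
  by_contra! hfrac
  obtain ⟨hx0, hxq⟩ := mem_xRegion_iff.1 hx.1
  have hi1 : x i < 1 := lt_of_le_of_ne (hx.1.1 i).2 hfrac.2
  rcases (hxq p hpc).eq_or_lt with hsum | hsum
  -- The clique has sum 1 while `x i < 1`, so another entry is positive.
  · obtain ⟨j, hj, hji, hxj⟩ : ∃ j ∈ p, j ≠ i ∧ x j ≠ 0 := by
      by_contra! h
      have := Finset.sum_eq_single_of_mem (f := x) i hi h
      linarith
    -- Leaving out a positive entry of `p` drops the sum below 1. Hence a tight clique inside `p`
    -- contains both `i` and `j`, and shifting mass between them preserves its sum.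
    have avoid : ∀ q, S.IsClique q → ∑ a ∈ q, x a = 1 → q ⊆ p → ∀ a ∈ p, x a ≠ 0 → a ∈ q := by
      intro q _ hs hqp a ha hxa
      by_contra haq
      have hlt := Finset.sum_lt_sum_of_subset hqp ha haq (lt_of_le_of_ne (hx0 a) (Ne.symm hxa))
        (fun b _ _ => hx0 b)
      linarith
    have hd := direction_eq_zero (d := Pi.single i 1 - Pi.single j 1) hx
      (fun a ha => by
        have h1 : a ≠ i := fun e => hfrac.1 (e ▸ ha)
        have h2 : a ≠ j := fun e => hxj (e ▸ ha)
        simp [h1, h2])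
      (fun q hq hs => by
        have hij : i ∈ q ↔ j ∈ q :=
          ⟨fun h => avoid q hq hs (hq.subset_of_mem hp hi h) j hj hxj,
            fun h => avoid q hq hs (hq.subset_of_mem hp hj h) i hi hfrac.1⟩
        simp [Finset.sum_sub_distrib, hij])
    have := congrFun hd i
    simp [hji.symm] at this
  -- Cliques through `i` lie in `p`, whose sum is below 1, so none of them is tight.
  · have hd := direction_eq_zero (d := Pi.single i 1) hx
      (fun a ha => by
        have h1 : a ≠ i := fun e => hfrac.1 (e ▸ ha)
        simp [h1])
      (fun q hq hs => by
        have hiq : i ∉ q := fun h => by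
          have := Finset.sum_le_sum_of_subset_of_nonneg (f := x) (hq.subset_of_mem hp hi h)
            (fun b _ _ => hx0 b)
          linarith
        simp [hiq])
    have := congrFun hd i
    simp at this

/-- Extreme points are integral on chains closed under conflicts: the alternating sum of the
fractional positions is a direction that respects all tight constraints. -/
theorem eq_zero_or_one_of_mem_chain {x : S.ConflictTuple → ℝ}
    (hx : x ∈ Set.extremePoints ℝ S.xRegion) {p : Finset S.ConflictTuple}
    (hp : ∀ i ∈ p, ∀ l : S.ConflictTuple, S.Conflict i l → l ∈ p) (hpc : S.IsChain p)
    {i : S.ConflictTuple} (hi : i ∈ p) : x i = 0 ∨ x i = 1 := by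
  obtain ⟨s, c, hinj, hmem, hadj⟩ := hpc
  -- `f` reads off the position in the chain; its default value 0 elsewhere is harmless, as `d`
  -- vanishes outside `p`.
  have hidx : ∃ f : S.ConflictTuple → ℕ, ∀ a, f (c a) = a :=
    ⟨Function.extend c (fun a => (a : ℕ)) 0, fun a => hinj.extend_apply _ _ a⟩
  obtain ⟨f, hf⟩ := hidx
  let d : S.ConflictTuple → ℝ := fun i =>
    if i ∈ p ∧ x i ≠ 0 ∧ x i ≠ 1 then (-1) ^ f i else 0
  have hd : d = 0 := by
    refine direction_eq_zero hx (fun a ha => by simp [d, ha]) fun q hq hs => ?_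
    by_cases hmeet : ∃ a, c a ∈ q
    · obtain ⟨a, ha⟩ := hmeet
      have hqp : q ⊆ p := hq.subset_of_mem hp ((hmem _).2 ⟨a, rfl⟩) ha
      by_cases hsingle : ∀ b ∈ q, b = c a
      · obtain rfl : q = {c a} := Finset.eq_singleton_iff_unique_mem.2 ⟨ha, hsingle⟩
        simp only [Finset.sum_singleton] at hs ⊢
        simp [d, hs]
      · push Not at hsingle
        obtain ⟨b', hb, hba⟩ := hsingle
        obtain ⟨b, rfl⟩ := (hmem b').1 (hqp hb)
        have hab : (a : ℕ) + 1 = b ∨ (b : ℕ) + 1 = a := (hadj a b).1 (hq _ ha _ hb hba.symm)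
        -- A third element would be adjacent to two consecutive positions, so a clique in a chain
        -- has at most two elements.
        obtain rfl : q = {c a, c b} := by
          ext e'
          simp only [Finset.mem_insert, Finset.mem_singleton]
          refine ⟨fun he => ?_, by rintro (rfl | rfl) <;> assumption⟩
          obtain ⟨e, rfl⟩ := (hmem e').1 (hqp he)
          by_contra! hne
          have h1 := (hadj a e).1 (hq _ ha _ he hne.1.symm)
          have h2 := (hadj b e).1 (hq _ hb _ he hne.2.symm)
          omega
        rw [Finset.sum_pair hba.symm] at hs ⊢
        have hpow : (-1 : ℝ) ^ (a : ℕ) + (-1) ^ (b : ℕ) = 0 := by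
          rcases hab with h | h <;> rw [← h, pow_succ] <;> ring
        -- In a tight pair both entries are integral or both are fractional; in the latter case the
        -- opposite signs cancel.
        have hb' : x (c b) = 1 - x (c a) := by linarith
        by_cases h0 : x (c a) = 0
        · simp [d, hb', h0]
        by_cases h1 : x (c a) = 1
        · simp [d, hb', h1]
        have h0' : (1 : ℝ) - x (c a) ≠ 0 := fun h => h1 (by linarith)
        have h1' : (1 : ℝ) - x (c a) ≠ 1 := fun h => h0 (by linarith)
        simp only [d, hb', hf, if_pos (And.intro (hqp ha) (And.intro h0 h1)),
          if_pos (And.intro (hqp hb) (And.intro h0' h1')), hpow]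
    · refine Finset.sum_eq_zero fun b hb => ?_
      have hbp : b ∉ p := fun h => by
        obtain ⟨a, rfl⟩ := (hmem b).1 h
        exact hmeet ⟨a, hb⟩
      simp [d, hbp]
  by_contra! hfrac
  have := congrFun hd i
  simp [d, hi, hfrac.1, hfrac.2] at this

/-- The extreme points of the region of the `x`-constraints are integral. -/
theorem eq_zero_or_one_of_mem_extremePoints_xRegion (hS : S.ConsistsOfChainsAndDisjointCliques)
    {x : S.ConflictTuple → ℝ} (hx : x ∈ Set.extremePoints ℝ S.xRegion) (i : S.ConflictTuple) :
    x i = 0 ∨ x i = 1 := by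
  obtain ⟨parts, hkind, hdisj, hcover⟩ := hS
  obtain ⟨l, hil⟩ := i.exists_conflict
  obtain ⟨p, hp, hip, -⟩ := hcover i l hil
  -- The part that covers a conflict of an element of `p` meets `p`, so by disjointness it is `p`.
  have hclosed : ∀ i ∈ p, ∀ l : S.ConflictTuple, S.Conflict i l → l ∈ p := by
    intro a ha b hab
    obtain ⟨p', hp', ha', hb'⟩ := hcover a b hab
    by_cases h : p = p'
    · exact h ▸ hb'
    · exact absurd ha' (Finset.disjoint_left.1 (hdisj p hp p' hp' h) ha)
  rcases hkind p hp with hc | hc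
  · exact eq_zero_or_one_of_mem_chain hx hclosed hc hip
  · exact eq_zero_or_one_of_mem_clique hx hclosed hc.1.1 hip

/-! ### Integrality of the y-variables -/

/-- At an extreme point with integral `x`-part, a direction in the `y`-variables that vanishes at
the integral entries and has sum zero in the rows of integral sum vanishes. -/
theorem provider_direction_eq_zero {X : S.DecisionVec} (hX : X ∈ Set.extremePoints ℝ S.lpRegion)
    (hint : ∀ i, X.1 i = 0 ∨ X.1 i = 1)
    {d : (Σ i : Fin n, {l : Fin n // l ∈ S.providers i}) → ℝ}
    (hd : ∀ p, X.2 p = 0 ∨ X.2 p = 1 → d p = 0)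
    (hrow : ∀ (i : Fin n) (z : ℤ),
      ∑ l : {l : Fin n // l ∈ S.providers i}, X.2 ⟨i, l⟩ = z →
        ∑ l : {l : Fin n // l ∈ S.providers i}, d ⟨i, l⟩ = 0) : d = 0 := by
  have hmain : ((0, d) : S.DecisionVec) = 0 := by
    refine eq_zero_of_eventually_add_smul_mem hX ?_
    obtain ⟨hx, hy, hp⟩ := hX.1
    have e0 : ∀ᶠ ε : ℝ in 𝓝 0, ∀ p, -X.2 p + ε * -d p ≤ 0 :=
      eventually_all.2 fun p => eventually_add_mul_le (by linarith [(hy p).1])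
        fun h => by rw [hd p (Or.inl (by linarith)), neg_zero]
    have e1 : ∀ᶠ ε : ℝ in 𝓝 0, ∀ p, X.2 p + ε * d p ≤ 1 :=
      eventually_all.2 fun p => eventually_add_mul_le (hy p).2 fun h => hd p (Or.inr h)
    have e2 : ∀ᶠ ε : ℝ in 𝓝 0, ∀ (i : Fin n) (hi : i ∈ S.conflictSet)
        (l : {l : Fin n // l ∈ S.providers i}), X.2 ⟨i, l⟩ + ε * d ⟨i, l⟩ ≤ X.1 ⟨i, hi⟩ :=
      eventually_all.2 fun i => eventually_all.2 fun hi => eventually_all.2 fun l =>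
        eventually_add_mul_le (hp.le_receiver i hi l) fun h => hd _ (h ▸ hint _)
    have e3 : ∀ᶠ ε : ℝ in 𝓝 0, ∀ (i : Fin n) (l : {l : Fin n // l ∈ S.providers i})
        (hl : l.1 ∈ S.conflictSet), X.2 ⟨i, l⟩ + ε * d ⟨i, l⟩ ≤ X.1 ⟨l.1, hl⟩ :=
      eventually_all.2 fun i => eventually_all.2 fun l => eventually_all.2 fun hl =>
        eventually_add_mul_le (hp.le_provider i l hl) fun h => hd _ (h ▸ hint _)
    have e4 : ∀ᶠ ε : ℝ in 𝓝 0, ∀ i : Fin n, i ∉ S.conflictSet →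
        ∑ l : {l : Fin n // l ∈ S.providers i}, X.2 ⟨i, l⟩
          + ε * ∑ l : {l : Fin n // l ∈ S.providers i}, d ⟨i, l⟩ ≤ (S.k : ℝ) :=
      eventually_all.2 fun i => eventually_all.2 fun hi =>
        eventually_add_mul_le (hp.sum_le i hi) fun h => hrow i S.k (by simpa using h)
    have e5 : ∀ᶠ ε : ℝ in 𝓝 0, ∀ (i : Fin n) (hi : i ∈ S.conflictSet),
        ∑ l : {l : Fin n // l ∈ S.providers i}, X.2 ⟨i, l⟩
          + ε * ∑ l : {l : Fin n // l ∈ S.providers i}, d ⟨i, l⟩ ≤ (S.k : ℝ) * X.1 ⟨i, hi⟩ :=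
      eventually_all.2 fun i => eventually_all.2 fun hi =>
        eventually_add_mul_le (hp.sum_le_mul i hi) fun h => by
          -- A tight row has the integral sum `k * x i`, so `hrow` applies.
          obtain ⟨z, hz⟩ := exists_intCast_of_eq_zero_or_one (hint ⟨i, hi⟩)
          exact hrow i (S.k * z) (by rw [h, hz]; push_cast; rfl)
    filter_upwards [e0, e1, e2, e3, e4, e5] with ε h0 h1 h2 h3 h4 h5
    have hfst : (X + ε • ((0, d) : S.DecisionVec)).1 = X.1 := by simp
    have hsnd : ∀ p, (X + ε • ((0, d) : S.DecisionVec)).2 p = X.2 p + ε * d p := fun p => by simp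
    refine ⟨hfst ▸ hx, fun p => ?_, ⟨?_, ?_, ?_, ?_⟩⟩
    · rw [hsnd]
      exact ⟨by linarith [h0 p], h1 p⟩
    · intro i hi l
      rw [hsnd, hfst]
      exact h2 i hi l
    · intro i l hl
      rw [hsnd, hfst]
      exact h3 i l hl
    · intro i hi
      simpa only [hsnd, Finset.sum_add_distrib, Finset.mul_sum] using h4 i hi
    · intro i hi
      simpa only [hsnd, hfst, Finset.sum_add_distrib, Finset.mul_sum] using h5 i hi
  exact congrArg Prod.snd hmain

/-- The `y`-part of an extreme point with integral `x`-part is integral. -/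
theorem provider_eq_zero_or_one {X : S.DecisionVec} (hX : X ∈ Set.extremePoints ℝ S.lpRegion)
    (hint : ∀ i, X.1 i = 0 ∨ X.1 i = 1) (p : Σ i : Fin n, {l : Fin n // l ∈ S.providers i}) :
    X.2 p = 0 ∨ X.2 p = 1 := by
  by_contra hfrac
  obtain ⟨i, l⟩ := p
  have hsingle : ∀ (l : {l : Fin n // l ∈ S.providers i}) (j : Fin n), j ≠ i →
      ∀ b : {l : Fin n // l ∈ S.providers j},
        (Pi.single (⟨i, l⟩ : Σ i : Fin n, {l : Fin n // l ∈ S.providers i}) (1 : ℝ) :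
          (Σ i : Fin n, {l : Fin n // l ∈ S.providers i}) → ℝ) ⟨j, b⟩ = 0 := fun l j hj b =>
    Pi.single_eq_of_ne (fun e => hj (congrArg Sigma.fst e)) _
  have hrowsum : ∀ l : {l : Fin n // l ∈ S.providers i},
      ∑ b : {l : Fin n // l ∈ S.providers i},
        (Pi.single (⟨i, l⟩ : Σ i : Fin n, {l : Fin n // l ∈ S.providers i}) (1 : ℝ) :
          (Σ i : Fin n, {l : Fin n // l ∈ S.providers i}) → ℝ) ⟨i, b⟩ = 1 := fun l => by
    rw [Finset.sum_eq_single_of_mem l (Finset.mem_univ l)]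
    · exact Pi.single_eq_same _ _
    · exact fun b _ hb => Pi.single_eq_of_ne (fun e => hb (by simpa using e)) _
  by_cases hz : ∃ z : ℤ, ∑ l : {l : Fin n // l ∈ S.providers i}, X.2 ⟨i, l⟩ = z
  · obtain ⟨z, hz⟩ := hz
    -- A row of integral sum cannot have exactly one fractional entry: that entry would be a
    -- difference of integers.
    obtain ⟨l', hne, hfrac'⟩ : ∃ l', l' ≠ l ∧ ¬ (X.2 ⟨i, l'⟩ = 0 ∨ X.2 ⟨i, l'⟩ = 1) := by
      by_contra! h
      have hrest : ∑ b ∈ Finset.univ.erase l, X.2 ⟨i, b⟩ ∈ (Int.castAddHom ℝ).range :=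
        sum_mem fun b hb => by
          obtain ⟨w, hw⟩ := exists_intCast_of_eq_zero_or_one (h b (Finset.ne_of_mem_erase hb))
          exact ⟨w, hw.symm⟩
      obtain ⟨w, hw⟩ := hrest
      have hw' : (w : ℝ) = ∑ b ∈ Finset.univ.erase l, X.2 ⟨i, b⟩ := hw
      rw [← Finset.add_sum_erase _ _ (Finset.mem_univ l), ← hw'] at hz
      exact hfrac (eq_zero_or_one_of_eq_intCast (z := z - w) (hX.1.2.1 _).1 (hX.1.2.1 _).2
        (by push_cast; linarith))
    have hd := provider_direction_eq_zero (d := Pi.single ⟨i, l⟩ 1 - Pi.single ⟨i, l'⟩ 1) hX hint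
      (fun p hp => by
        have h1 : p ≠ ⟨i, l⟩ := fun e => hfrac (e ▸ hp)
        have h2 : p ≠ ⟨i, l'⟩ := fun e => hfrac' (e ▸ hp)
        simp [h1, h2])
      (fun j _ _ => by
        simp only [Pi.sub_apply, Finset.sum_sub_distrib]
        by_cases hj : j = i
        · subst hj
          rw [hrowsum, hrowsum, sub_self]
        · simp only [hsingle _ j hj, Finset.sum_const_zero, sub_self])
    have := congrFun hd ⟨i, l⟩
    simp [hne.symm] at this
  -- Row `i` has a non-integral sum, so it imposes no condition on the direction.
  · have hd := provider_direction_eq_zero (d := Pi.single ⟨i, l⟩ 1) hX hint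
      (fun p hp => by
        have h1 : p ≠ ⟨i, l⟩ := fun e => hfrac (e ▸ hp)
        simp [h1])
      (fun j z hjz => by
        have hj : j ≠ i := by
          rintro rfl
          exact hz ⟨z, hjz⟩
        simp only [hsingle _ j hj, Finset.sum_const_zero])
    have := congrFun hd ⟨i, l⟩
    simp at this

/-! ### Comparison with the integer program -/

/-- Integral points that satisfy the non-conflict constraints satisfy all clique constraints. -/
theorem NonConflict.cliqueConstraints {x : S.ConflictTuple → ℝ} (hx : S.NonConflict x)
    (hint : ∀ i, x i = 0 ∨ x i = 1) : S.CliqueConstraints x := by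
  intro q hq
  -- An entry 1 forces all other entries of the clique to be 0 by the pair constraints.
  by_cases h : ∃ i ∈ q, x i = 1
  · obtain ⟨i, hi, hi1⟩ := h
    rw [Finset.sum_eq_single_of_mem i hi, hi1]
    intro l hl hli
    have := hx i l (hq i hi l hl hli.symm)
    rcases hint l with h | h
    · exact h
    · linarith
  · push Not at h
    rw [Finset.sum_eq_zero fun i hi => (hint i).resolve_right (h i hi)]
    exact zero_le_one

theorem ilpRegion_subset_lpRegion : S.ilpRegion ⊆ S.lpRegion := by
  rintro X ⟨hx, hy, hn, hp⟩
  have hbox : ∀ r : ℝ, r = 0 ∨ r = 1 → 0 ≤ r ∧ r ≤ 1 := by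
    rintro r (rfl | rfl) <;> simp
  exact ⟨⟨fun i => hbox _ (hx i), hn, hn.cliqueConstraints hx⟩, fun p => hbox _ (hy p), hp⟩

end RepairInstance

end

theorem mainTheorem5 {V : Type*} [LinearOrder V] {n m : ℕ} (S : RepairInstance V n m)
    (hS : S.ConsistsOfChainsAndDisjointCliques) (X : S.DecisionVec)
    (hLP : S.IsLPSolution X) (hX : S.IsXSolution X) :
    S.IsILPSolution X := by
  have hx := RepairInstance.eq_zero_or_one_of_mem_extremePoints_xRegion hS hX.2
  exact ⟨⟨hx, RepairInstance.provider_eq_zero_or_one hLP.1 hx, hX.1.1.2.1, hX.1.2.2⟩,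
    fun X' hX' => hLP.2 X' (RepairInstance.ilpRegion_subset_lpRegion hX')⟩
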